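/- Let $d,T\ge 1$ be integers, $f:\mathbb{R}^d\to\mathbb{R}$ convex, $l:\mathbb{R}^d\to\mathbb{R}$ continuous with $l(x)\le G$ for all $x$, where $G>0$. AdaGrad++ with inputs $x_0\in\mathbb{R}^d$, $\eta_0=\varepsilon>0$ and $\rho\ge 0$ queries a stochastic gradient oracle at its iterates $x_0,\dots,x_T$ and receives random answers $g_0,\dots,g_T$ which satisfy, for every $t\le T$, almost surely, $\mathbb{E}[g_t\mid\mathcal{F}_t]\in\partial f(x_t)$ and $\|g_t\|_2\le l(x_t)$, where $(\mathcal{F}_t)$ is a filtration such that $g_t$ is $\mathcal{F}_{t+1}$-measurable. It performs, with entrywise squares and roots, $$s_t=\Big(\sum_{k=0}^t g_k^2\Big)^{1/2},\qquad x_{t+1}=x_t-\eta_t\,(\rho+\mathrm{diag}(s_t))^{-1}g_t,\qquad \eta_{t+1}=\max\big(\eta_t,\ \|x_{t+1}-x_0\|_2/\sqrt d\big)$$ (a coordinate in which $\rho+s_t$ vanishes is left unchanged). Let $\tau\in\arg\max_{t\le T}\sum_{i=0}^{t-1}\eta_i/\eta_t$ be measurable, $\bar x_\tau=\sum_{t<\tau}\eta_t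 x_t\big/\sum_{t<\tau}\eta_t$, and, for a point $x_*\in\mathbb{R}^d$, $D_\tau=\max_{t\le\tau}\|x_t-x_*\|_\infty$. For every $\kappa>0$ there is a constant $C>0$, depending only on $\kappa$, such that the following holds for all such data. Suppose that $\|s_\tau\|_2\le G\,T^{1/2-\alpha}$ almost surely for some $\alpha\in[0,1/2]$, that $\rho\sqrt d\le\kappa G$, and that $x_*\in\mathbb{R}^d$ is such that $\eta_0\le\kappa D_\tau$ almost surely. Then for every $\delta\in(0,1)$, with probability at least $1-\delta$, $$f(\bar x_\tau)\le f(x_*)+\frac{C}{\eta_0}\cdot\frac{D_\tau^2\,G\sqrt d}{T^{1/2+\alpha}}\cdot\Big(1+\log\frac{\eta_T}{\eta_0}\Big)\log\frac{60\log(6T)}{\delta}.$$ -/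

import Mathlib

open MeasureTheory

noncomputable section

namespace AdaGradPP

/-- `ℝ^d` with the Euclidean norm. -/
abbrev Vec (d : ℕ) : Type := EuclideanSpace ℝ (Fin d)

/-- The `ℓ_∞` norm `max_i |x_i|` (the norm of the underlying tuple in `Fin d → ℝ`). -/
def linfNorm {d : ℕ} (x : Vec d) : ℝ := ‖WithLp.ofLp x‖

/-- The subdifferential `∂f(x)` of a function on `ℝ^d`. -/
def subdifferential {d : ℕ} (f : Vec d → ℝ) (x : Vec d) : Set (Vec d) :=
  {v | ∀ y, f x + inner ℝ v (y - x) ≤ f y}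

/-- The accumulator `s_t = (∑_{k ≤ t} g_k²)^{1/2}`, with entrywise square and square root. -/
def accum {d : ℕ} (g : ℕ → Vec d) (t : ℕ) : Vec d :=
  WithLp.toLp 2 fun i => Real.sqrt (∑ k ∈ Finset.range (t + 1), (g k i) ^ 2)

/-- The state `(x_t, η_t)` of AdaGrad++ started at `x₀` with parameters `η₀ = ε` and `reg`
(the constant added to the preconditioner), when the stochastic gradients received are
`g 0, g 1, …`. Only `g 0, …, g (t - 1)` matter for the state at time `t`:
`x_{t+1} = x_t - η_t (reg + diag s_t)⁻¹ g_t` and `η_{t+1} = max (η_t, ‖x_{t+1} - x₀‖₂ / √d)`.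
If `reg = 0`, a coordinate of `s_t` can only vanish together with that of `g_t`, and the
coordinate is then left unchanged. -/
def state {d : ℕ} (x₀ : Vec d) (ε reg : ℝ) (g : ℕ → Vec d) : ℕ → Vec d × ℝ
  | 0 => (x₀, ε)
  | t + 1 =>
    let x := (state x₀ ε reg g t).1
    let η := (state x₀ ε reg g t).2
    let x' : Vec d := WithLp.toLp 2 fun i => x i - η * ((reg + accum g t i)⁻¹ * g t i)
    (x', max η (‖x' - x₀‖ / Real.sqrt d))

/-- The iterate `x_t`. -/
def iterate {d : ℕ} (x₀ : Vec d) (ε reg : ℝ) (g : ℕ → Vec d) (t : ℕ) : Vec d :=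
  (state x₀ ε reg g t).1

/-- The step size `η_t`. -/
def stepSize {d : ℕ} (x₀ : Vec d) (ε reg : ℝ) (g : ℕ → Vec d) (t : ℕ) : ℝ :=
  (state x₀ ε reg g t).2

/-- `t ∈ argmax_{t ≤ T} ∑_{i < t} η_i / η_t`. -/
def IsBestTime (η : ℕ → ℝ) (T t : ℕ) : Prop :=
  t ≤ T ∧ ∀ t' ≤ T,
    ∑ i ∈ Finset.range t', η i / η t' ≤ ∑ i ∈ Finset.range t, η i / η t

/-- The weighted average `(∑_{k < t} η_k x_k) / (∑_{k < t} η_k)`. -/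
def average {d : ℕ} (η : ℕ → ℝ) (x : ℕ → Vec d) (t : ℕ) : Vec d :=
  (∑ k ∈ Finset.range t, η k)⁻¹ • ∑ k ∈ Finset.range t, η k • x k

/-- `D_t = max_{k ≤ t} ‖x_k - x_*‖_∞`. -/
def maxDist {d : ℕ} (x : ℕ → Vec d) (xs : Vec d) (t : ℕ) : ℝ :=
  (Finset.range (t + 1)).sup' Finset.nonempty_range_add_one fun k => linfNorm (x k - xs)

/-- `g 0, …, g T` are the answers of a stochastic gradient oracle for `f` to the queries
`x 0, …, x T`, with norm bound `l`: `ℱ t` is the information available before the query `x t` is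
answered, the answer `g t` is known at time `t + 1`, it is conditionally unbiased,
`𝔼[g_t | ℱ_t] ∈ ∂f(x_t)`, and `‖g_t‖₂ ≤ l(x_t)`, almost surely. (The iterates of AdaGrad++ are
functions of the earlier answers, so that `x t` is then automatically `ℱ t`-measurable.) -/
structure IsOracleAnswer {d : ℕ} {Ω : Type*} {m : MeasurableSpace Ω} (μ : Measure Ω)
    (ℱ : Filtration ℕ m) (f l : Vec d → ℝ) (x g : ℕ → Ω → Vec d) (T : ℕ) : Prop where
  measurable_answer : ∀ t ≤ T, StronglyMeasurable[ℱ (t + 1)] (g t)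
  unbiased : ∀ t ≤ T, ∀ᵐ ω ∂μ, (μ[g t | ℱ t]) ω ∈ subdifferential f (x t ω)
  norm_le : ∀ t ≤ T, ∀ᵐ ω ∂μ, ‖g t ω‖ ≤ l (x t ω)

/-- The logarithmic factor `(1 + log (η_T / η₀)) · log (60 log (6 T) / p)`. -/
def logFactor (η : ℕ → ℝ) (T : ℕ) (p : ℝ) : ℝ :=
  (1 + Real.log (η T / η 0)) * Real.log (60 * Real.log (6 * T) / p)

end AdaGradPP

end

/-! Write $S=\sum_{k<\tau}\eta_k$ and let $v_k=\mathbb E[g_k\mid\mathcal F_k]$, a subgradient at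
$x_k$. By convexity, $S\,(f(\bar x_\tau)-f(x_*))\le\sum_{k<\tau}\eta_k\langle v_k,x_k-x_*\rangle$;
split $v_k=g_k+(v_k-g_k)$.

The $g_k$ part is an AdaGrad regret. The weight $\eta_k$ is also the step length, so the sum
telescopes in each coordinate, and $\eta_\tau=O(D_\tau)$ makes it $O(D_\tau^2W)$ with $W=\sqrt
d\,G\,T^{1/2-\alpha}$ (`sum_stepSize_mul_inner_le`, `stepSize_le`).

In the noise part, pull out the nondecreasing weights $\eta_kD_k$. Summation by parts
(`sum_mul_le_of_abs_sum_le`) leaves $2\eta_\tau D_\tau$ times the largest partial sum of a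
martingale whose directions $(x_k-x_*)/D_k$ are predictable and of norm at most $\sqrt d$. An
exponential supermartingale controls all partial sums at once in terms of the observed squares
(`measureReal_exists_lt_abs_sum_le`). Both features matter: $\tau$ need not be a stopping time, and
$s_t$ is controlled only up to $\tau$. Since $W$ is deterministic, a single exponential parameter
suffices and costs only $\log(2/\delta)$; the iterated logarithm in the claim is slack.

Finally, a pigeonhole argument bounds $S$ below by a multiple of $\eta_0T/(1+\log(\eta_T/\eta_0))$
(`IsBestTime.le_sum`). -/

namespace AdaGradPP

/-! ### Inequalities for real sequences -/

/-- If `η` is nondecreasing and positive, then at the best time the sum of the step sizes is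
at least of order `η₀ T / (1 + log (η_T / η₀))`. -/
theorem IsBestTime.le_sum {η : ℕ → ℝ} (hη : Monotone η) (h0 : 0 < η 0) {T τ : ℕ} (hT : 1 ≤ T)
    (hτ : IsBestTime η T τ) :
    η 0 * T / (12 * (1 + Real.log (η T / η 0))) ≤ ∑ i ∈ Finset.range τ, η i := by
  have hpos : ∀ t, 0 < η t := fun t => h0.trans_le (hη (Nat.zero_le t))
  set L := Real.log (η T / η 0) with hL
  have hL0 : 0 ≤ L := Real.log_nonneg ((one_le_div h0).2 (hη (Nat.zero_le T)))
  have hexpL : Real.exp L = η T / η 0 := Real.exp_log (div_pos (hpos T) h0)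
  have hTpos : (0 : ℝ) < T := by exact_mod_cast hT
  set n := ⌊(T : ℝ) / (2 * (1 + L))⌋₊ with hn
  have hden : 0 < 2 * (1 + L) := by positivity
  -- If the window length `n` is zero, then `T < 2 * (1 + L)` and the single term `η 0` suffices.
  rcases Nat.eq_zero_or_pos n with hn0 | hn1
  · have hlt : (T : ℝ) < 2 * (1 + L) := by
      have := Nat.floor_eq_zero.1 (hn.symm.trans hn0)
      rwa [div_lt_one hden] at this
    have hτ1 : 0 < τ := by
      rcases Nat.eq_zero_or_pos τ with h | h
      · have := hτ.2 1 hT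
        rw [h] at this
        simp only [Finset.range_one, Finset.sum_singleton, Finset.range_zero,
          Finset.sum_empty] at this
        exact absurd (div_pos h0 (hpos 1)) (not_lt.2 this)
      · exact h
    have hsum : η 0 ≤ ∑ i ∈ Finset.range τ, η i :=
      Finset.single_le_sum (f := η) (fun i _ => (hpos i).le) (Finset.mem_range.2 hτ1)
    refine le_trans ?_ hsum
    rw [div_le_iff₀ (by positivity)]
    exact mul_le_mul_of_nonneg_left (by linarith) h0.le
  · have hnle : (n : ℝ) * (2 * (1 + L)) ≤ T :=
      (le_div_iff₀ hden).1 (Nat.floor_le (by positivity))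
    have hnge : (T : ℝ) < (n + 1) * (2 * (1 + L)) :=
      (div_lt_iff₀ hden).1 (Nat.lt_floor_add_one _)
    have hn1' : (1 : ℝ) ≤ n := by exact_mod_cast hn1
    -- Otherwise `η` would grow by a factor above `e` over each of `⌊L⌋₊ + 1` consecutive windows,
    -- all of which fit below `T`, contradicting `η T = exp L * η 0`. The window before `t` then has
    -- `n` ratios, each at least `1 / e ≥ 1 / 3`.
    obtain ⟨t, hnt, htT, ht⟩ : ∃ t, n ≤ t ∧ t ≤ T ∧ η t ≤ Real.exp 1 * η (t - n) := by
      by_contra! hcon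
      have hgrow : ∀ j : ℕ, j * n ≤ T → Real.exp j * η 0 ≤ η (j * n) := by
        intro j
        induction j with
        | zero => intro _; simp
        | succ j ih =>
          intro hj
          have hj' : (j + 1) * n - n = j * n := by rw [Nat.succ_mul]; omega
          have h1 := hcon ((j + 1) * n) (Nat.le_mul_of_pos_left _ (Nat.succ_pos j)) hj
          rw [hj'] at h1
          have h2 := ih ((Nat.mul_le_mul_right n (Nat.le_succ j)).trans hj)
          push_cast
          rw [Real.exp_add, mul_comm (Real.exp j), mul_assoc]
          exact (mul_le_mul_of_nonneg_left h2 (Real.exp_pos 1).le).trans h1.le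
      have hj : ((⌊L⌋₊ + 1) * n : ℕ) ≤ T := by
        have h1 : (⌊L⌋₊ : ℝ) ≤ L := Nat.floor_le hL0
        have h2 : (((⌊L⌋₊ + 1) * n : ℕ) : ℝ) ≤ T := by
          push_cast
          nlinarith
        exact_mod_cast h2
      have h1 := (hgrow _ hj).trans (hη hj)
      have h2 : Real.exp L < Real.exp ((⌊L⌋₊ + 1 : ℕ) : ℝ) := by
        refine Real.exp_lt_exp.2 ?_
        push_cast
        exact Nat.lt_floor_add_one L
      rw [hexpL, div_lt_iff₀ h0] at h2
      exact absurd h1 (not_le.2 h2)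
    have hM : (n : ℝ) / 3 ≤ ∑ i ∈ Finset.range τ, η i / η τ := by
      refine le_trans ?_ (hτ.2 t htT)
      have hsub : Finset.Ico (t - n) t ⊆ Finset.range t := fun i hi =>
        Finset.mem_range.2 (Finset.mem_Ico.1 hi).2
      refine le_trans ?_ (Finset.sum_le_sum_of_subset_of_nonneg hsub
        fun i _ _ => (div_pos (hpos i) (hpos t)).le)
      have hcard : (Finset.Ico (t - n) t).card = n := by
        rw [Nat.card_Ico]; omega
      have := Finset.card_nsmul_le_sum (Finset.Ico (t - n) t) (fun i => η i / η t) (1 / 3)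
        (fun i hi => by
          rw [le_div_iff₀ (hpos t)]
          have h1 := hη (Finset.mem_Ico.1 hi).1
          have h2 := Real.exp_one_lt_three
          have h3 := hpos (t - n)
          nlinarith)
      rw [hcard, nsmul_eq_mul] at this
      linarith
    rw [← Finset.sum_div, le_div_iff₀ (hpos τ)] at hM
    refine le_trans ?_ hM
    have h1 : (n : ℝ) / 3 * η 0 ≤ n / 3 * η τ :=
      mul_le_mul_of_nonneg_left (hη (Nat.zero_le τ)) (by positivity)
    refine le_trans ?_ h1
    rw [div_le_iff₀ (by positivity)]
    -- As `n ≥ 1`, `T < (n + 1) * 2 * (1 + L) ≤ 4 * n * (1 + L)`; this fixes the constant 12.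
    have h2 : (T : ℝ) ≤ n / 3 * (12 * (1 + L)) := by nlinarith
    nlinarith

/-- Summation by parts: weighting by a nondecreasing sequence. -/
theorem sum_mul_le_of_abs_sum_le {a b : ℕ → ℝ} {R : ℝ} (ha : Monotone a) (ha0 : 0 ≤ a 0) (n : ℕ)
    (hR : ∀ k ≤ n, |∑ i ∈ Finset.range k, b i| ≤ R) :
    ∑ i ∈ Finset.range n, a i * b i ≤ 2 * a n * R := by
  -- Each induction step adds an increment of `a` times a partial sum of `b`, so the errors
  -- telescope.
  have key : ∀ k ≤ n, |∑ i ∈ Finset.range k, a i * b i - a k * ∑ i ∈ Finset.range k, b i|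
      ≤ (a k - a 0) * R := by
    intro k
    induction k with
    | zero => simp
    | succ k ih =>
      intro hk
      have h1 := ih (by omega)
      have h2 := hR (k + 1) hk
      have h3 : a k ≤ a (k + 1) := ha (Nat.le_succ k)
      have h4 : |(a k - a (k + 1)) * ∑ i ∈ Finset.range (k + 1), b i| ≤ (a (k + 1) - a k) * R := by
        rw [abs_mul, abs_sub_comm, abs_of_nonneg (sub_nonneg.2 h3)]
        exact mul_le_mul_of_nonneg_left h2 (sub_nonneg.2 h3)
      have h5 : ∑ i ∈ Finset.range (k + 1), a i * b i
          - a (k + 1) * ∑ i ∈ Finset.range (k + 1), b i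
          = (∑ i ∈ Finset.range k, a i * b i - a k * ∑ i ∈ Finset.range k, b i)
            + (a k - a (k + 1)) * ∑ i ∈ Finset.range (k + 1), b i := by
        rw [Finset.sum_range_succ, Finset.sum_range_succ b]; ring
      rw [h5]
      refine (abs_add_le _ _).trans ?_
      linarith
  have h1 := (abs_le.1 (key n le_rfl)).2
  have h2 := (abs_le.1 (hR n le_rfl)).2
  have hR0 : 0 ≤ R := (abs_nonneg _).trans (hR n le_rfl)
  have han : 0 ≤ a n := ha0.trans (ha (Nat.zero_le n))
  nlinarith [mul_le_mul_of_nonneg_left h2 han, mul_nonneg ha0 hR0]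

/-- The AdaGrad regret bound in one coordinate. -/
theorem sum_coordinate_le {r D E : ℝ} {y η γ : ℕ → ℝ} {z : ℝ} {n : ℕ} (hr : 0 ≤ r)
    (hy : ∀ k < n, y (k + 1)
      = y k - η k * ((r + Real.sqrt (∑ j ∈ Finset.range (k + 1), γ j ^ 2))⁻¹ * γ k))
    (hD : ∀ k ≤ n, |y k - z| ≤ D) (hη : ∀ k < n, 0 ≤ η k) (hE : ∀ k < n, η k ≤ E) :
    ∑ k ∈ Finset.range n, η k * (γ k * (y k - z))
      ≤ (r + Real.sqrt (∑ j ∈ Finset.range n, γ j ^ 2)) * D ^ 2 / 2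
        + E ^ 2 * Real.sqrt (∑ j ∈ Finset.range n, γ j ^ 2) := by
  set s : ℕ → ℝ := fun k => Real.sqrt (∑ j ∈ Finset.range k, γ j ^ 2) with hs
  have hs0 : ∀ k, 0 ≤ s k := fun k => Real.sqrt_nonneg _
  have hD2 : ∀ k ≤ n, (y k - z) ^ 2 ≤ D ^ 2 := fun k hk => sq_le_sq' (abs_le.1 (hD k hk)).1
    (abs_le.1 (hD k hk)).2
  -- The term `(r + s k) * (D ^ 2 - (y k - z) ^ 2) / 2` is a potential: since the squared distance
  -- never exceeds `D ^ 2`, replacing `s k` by `s (k + 1)` can only increase it.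
  suffices H : ∀ k ≤ n, ∑ j ∈ Finset.range k, η j * (γ j * (y j - z))
      ≤ (r + s k) * (D ^ 2 - (y k - z) ^ 2) / 2 + E ^ 2 * s k by
    have h1 := H n le_rfl
    have h2 : 0 ≤ (r + s n) * (y n - z) ^ 2 :=
      mul_nonneg (add_nonneg hr (hs0 n)) (sq_nonneg _)
    change _ ≤ (r + s n) * D ^ 2 / 2 + E ^ 2 * s n
    linarith
  intro k
  induction k with
  | zero =>
    intro h
    have := mul_nonneg hr (sub_nonneg.2 (hD2 0 h))
    simp only [hs, Finset.range_zero, Finset.sum_empty, Real.sqrt_zero]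
    linarith
  | succ k ih =>
    intro hk
    have h1 := ih (by omega)
    have hsq : s (k + 1) ^ 2 = s k ^ 2 + γ k ^ 2 := by
      simp only [hs]
      rw [Real.sq_sqrt (Finset.sum_nonneg fun _ _ => sq_nonneg _),
        Real.sq_sqrt (Finset.sum_nonneg fun _ _ => sq_nonneg _), Finset.sum_range_succ]
    have hmono : s k ≤ s (k + 1) := by
      refine abs_le_of_sq_le_sq' ?_ (hs0 _) |>.2
      rw [hsq]; nlinarith [sq_nonneg (γ k)]
    have hyk := hy k hk
    change y (k + 1) = y k - η k * ((r + s (k + 1))⁻¹ * γ k) at hyk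
    rw [Finset.sum_range_succ]
    have hmon2 : 0 ≤ (s (k + 1) - s k) * (D ^ 2 - (y k - z) ^ 2) :=
      mul_nonneg (sub_nonneg.2 hmono) (sub_nonneg.2 (hD2 k (by omega)))
    have hEk : η k ^ 2 ≤ E ^ 2 := pow_le_pow_left₀ (hη k hk) (hE k hk) 2
    have hEs : η k ^ 2 * (s (k + 1) - s k) ≤ E ^ 2 * (s (k + 1) - s k) :=
      mul_le_mul_of_nonneg_right hEk (sub_nonneg.2 hmono)
    have hh0 : 0 ≤ r + s (k + 1) := add_nonneg hr (hs0 _)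
    set h := r + s (k + 1) with hh
    rcases hh0.eq_or_lt with hz | hp
    -- The preconditioner vanishes only if `γ k = 0`; the convention `0⁻¹ = 0` then leaves `y`
    -- unchanged.
    · have hs1 : s (k + 1) = 0 := by linarith [hs0 (k + 1)]
      have hs2 : s k = 0 := by linarith [hs0 k]
      have hγ : γ k = 0 := by
        rw [hs1, hs2] at hsq
        nlinarith
      rw [hγ] at hyk ⊢
      have hyk' : y (k + 1) = y k := by simpa using hyk
      rw [hyk']
      nlinarith
    · set u := h⁻¹ * γ k with hu
      have hγ : γ k = h * u := by rw [hu, mul_inv_cancel_left₀ hp.ne']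
      -- `(h * u) ^ 2 = γ k ^ 2` is the increment of `s ^ 2`, a difference of squares whose factor
      -- `s (k + 1) + s k` is at most `2 * h`.
      have h2 : h * u ^ 2 ≤ 2 * (s (k + 1) - s k) := by
        have h3 : h * (h * u ^ 2) ≤ h * (2 * (s (k + 1) - s k)) := by
          have : h * (h * u ^ 2) = (s (k + 1) - s k) * (s (k + 1) + s k) := by
            rw [hγ] at hsq; nlinarith
          rw [this]
          have : s (k + 1) + s k ≤ 2 * h := by linarith
          nlinarith
        exact le_of_mul_le_mul_left h3 hp
      have h4 : η k * (γ k * (y k - z))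
          = h * ((y k - z) ^ 2 - (y (k + 1) - z) ^ 2) / 2 + η k ^ 2 * (h * u ^ 2) / 2 := by
        rw [hγ, hyk]; ring
      have h5 : η k ^ 2 * (h * u ^ 2) ≤ η k ^ 2 * (2 * (s (k + 1) - s k)) :=
        mul_le_mul_of_nonneg_left h2 (sq_nonneg _)
      rw [h4]
      have h6 : (r + s k) * (D ^ 2 - (y k - z) ^ 2)
          = h * (D ^ 2 - (y k - z) ^ 2) - (s (k + 1) - s k) * (D ^ 2 - (y k - z) ^ 2) := by
        rw [hh]; ring
      nlinarith

/-! ### Norms, iterates and the weighted regret -/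

variable {d : ℕ}

theorem abs_apply_le_linfNorm (x : Vec d) (i : Fin d) : |x i| ≤ linfNorm x := by
  simpa [linfNorm] using norm_le_pi_norm (WithLp.ofLp x) i

theorem linfNorm_nonneg (x : Vec d) : 0 ≤ linfNorm x := norm_nonneg _

theorem norm_le_sqrt_mul_linfNorm (x : Vec d) : ‖x‖ ≤ Real.sqrt d * linfNorm x := by
  rw [EuclideanSpace.norm_eq]
  refine Real.sqrt_le_iff.2 ⟨mul_nonneg (Real.sqrt_nonneg _) (linfNorm_nonneg x), ?_⟩
  rw [mul_pow, Real.sq_sqrt (Nat.cast_nonneg d)]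
  calc ∑ i, ‖x i‖ ^ 2 ≤ ∑ _i : Fin d, linfNorm x ^ 2 :=
        Finset.sum_le_sum fun i _ =>
          pow_le_pow_left₀ (norm_nonneg _) (abs_apply_le_linfNorm x i) 2
    _ = d * linfNorm x ^ 2 := by simp

theorem linfNorm_sub_le (x y z : Vec d) :
    linfNorm (x - y) ≤ linfNorm (x - z) + linfNorm (y - z) := by
  have h : WithLp.ofLp (x - y) = WithLp.ofLp (x - z) - WithLp.ofLp (y - z) := by
    ext i; simp
  unfold linfNorm
  rw [h]
  exact norm_sub_le _ _

theorem sum_le_sqrt_mul_norm (x : Vec d) : ∑ i, x i ≤ Real.sqrt d * ‖x‖ := by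
  rw [EuclideanSpace.norm_eq, ← Real.sqrt_mul (Nat.cast_nonneg d)]
  refine Real.le_sqrt_of_sq_le ?_
  have := sq_sum_le_card_mul_sum_sq (s := Finset.univ) (f := fun i => x i)
  simpa using this

theorem linfNorm_le_maxDist (x : ℕ → Vec d) (xs : Vec d) {k t : ℕ} (hk : k ≤ t) :
    linfNorm (x k - xs) ≤ maxDist x xs t :=
  Finset.le_sup' (fun k => linfNorm (x k - xs)) (Finset.mem_range.2 (Nat.lt_succ_of_le hk))

theorem maxDist_nonneg (x : ℕ → Vec d) (xs : Vec d) (t : ℕ) : 0 ≤ maxDist x xs t :=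
  (linfNorm_nonneg _).trans (linfNorm_le_maxDist x xs le_rfl)

theorem maxDist_mono (x : ℕ → Vec d) (xs : Vec d) : Monotone (maxDist x xs) := fun _ _ h =>
  Finset.sup'_le _ _ fun _ hk =>
    linfNorm_le_maxDist x xs ((Nat.lt_succ_iff.1 (Finset.mem_range.1 hk)).trans h)

section Iterates

variable (x₀ : Vec d) (ε reg : ℝ) (g : ℕ → Vec d)

theorem iterate_succ_apply (t : ℕ) (i : Fin d) :
    iterate x₀ ε reg g (t + 1) i = iterate x₀ ε reg g t i
      - stepSize x₀ ε reg g t * ((reg + accum g t i)⁻¹ * g t i) := rfl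

theorem stepSize_succ (t : ℕ) :
    stepSize x₀ ε reg g (t + 1)
      = max (stepSize x₀ ε reg g t) (‖iterate x₀ ε reg g (t + 1) - x₀‖ / Real.sqrt d) := rfl

theorem stepSize_mono : Monotone (stepSize x₀ ε reg g) :=
  monotone_nat_of_le_succ fun t => by rw [stepSize_succ]; exact le_max_left _ _

theorem le_stepSize (t : ℕ) : ε ≤ stepSize x₀ ε reg g t :=
  stepSize_mono x₀ ε reg g (Nat.zero_le t)

/-- The factor $\sqrt d$ in the step-size rule converts $\ell_2$ to $\ell_\infty$, and the triangle
inequality through `xs` costs `2 * maxDist`. -/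
theorem stepSize_le {κ : ℝ} {xs : Vec d} {n : ℕ} (hd : 0 < d) (hκ : 0 ≤ κ)
    (hε : ε ≤ κ * maxDist (iterate x₀ ε reg g) xs n) {t : ℕ} (ht : t ≤ n) :
    stepSize x₀ ε reg g t ≤ (κ + 2) * maxDist (iterate x₀ ε reg g) xs n := by
  have hD := maxDist_nonneg (iterate x₀ ε reg g) xs n
  induction t with
  | zero => exact hε.trans (by nlinarith)
  | succ t ih =>
    rw [stepSize_succ]
    refine max_le (ih (by omega)) ?_
    have hd' : 0 < Real.sqrt d := Real.sqrt_pos.2 (by exact_mod_cast hd)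
    rw [div_le_iff₀' hd']
    refine (norm_le_sqrt_mul_linfNorm _).trans (mul_le_mul_of_nonneg_left ?_ hd'.le)
    refine (linfNorm_sub_le _ _ xs).trans ?_
    have h1 := linfNorm_le_maxDist (iterate x₀ ε reg g) xs ht
    have h2 := linfNorm_le_maxDist (iterate x₀ ε reg g) xs (Nat.zero_le n)
    change linfNorm (x₀ - xs) ≤ _ at h2
    nlinarith [mul_nonneg hκ hD]

/-- The weighted regret of AdaGrad++ against the received gradients. -/
theorem sum_stepSize_mul_inner_le {E : ℝ} {xs : Vec d} {n : ℕ} (hε : 0 ≤ ε) (hreg : 0 ≤ reg)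
    (hE : stepSize x₀ ε reg g n ≤ E) :
    ∑ k ∈ Finset.range n, stepSize x₀ ε reg g k * inner ℝ (g k) (iterate x₀ ε reg g k - xs)
      ≤ (d * reg + Real.sqrt d * ‖accum g n‖) * maxDist (iterate x₀ ε reg g) xs n ^ 2 / 2
        + E ^ 2 * (Real.sqrt d * ‖accum g n‖) := by
  set D := maxDist (iterate x₀ ε reg g) xs n with hD
  have hη0 : ∀ k, 0 ≤ stepSize x₀ ε reg g k := fun k => hε.trans (le_stepSize _ _ _ _ k)
  have hcoord : ∀ i : Fin d, ∑ k ∈ Finset.range n,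
      stepSize x₀ ε reg g k * (g k i * (iterate x₀ ε reg g k i - xs i))
        ≤ (reg + accum g n i) * D ^ 2 / 2 + E ^ 2 * accum g n i := by
    intro i
    have h1 := sum_coordinate_le (r := reg) (D := D) (E := E)
      (y := fun k => iterate x₀ ε reg g k i) (η := stepSize x₀ ε reg g) (γ := fun k => g k i)
      (z := xs i) (n := n) hreg (fun k _ => iterate_succ_apply x₀ ε reg g k i)
      (fun k hk => (abs_apply_le_linfNorm (iterate x₀ ε reg g k - xs) i).trans
        (linfNorm_le_maxDist _ _ hk)) (fun k _ => hη0 k)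
      (fun k hk => (stepSize_mono x₀ ε reg g hk.le).trans hE)
    -- `accum g n` includes `g n`, one term more than the regret needs.
    have h2 : Real.sqrt (∑ j ∈ Finset.range n, g j i ^ 2) ≤ accum g n i :=
      Real.sqrt_le_sqrt (Finset.sum_le_sum_of_subset_of_nonneg
        (Finset.range_mono (Nat.le_succ n)) fun _ _ _ => sq_nonneg _)
    refine h1.trans ?_
    gcongr
  have hsum := Finset.sum_le_sum fun i (_ : i ∈ Finset.univ) => hcoord i
  rw [Finset.sum_comm] at hsum
  have hl : ∑ k ∈ Finset.range n, stepSize x₀ ε reg g k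
        * inner ℝ (g k) (iterate x₀ ε reg g k - xs)
      = ∑ k ∈ Finset.range n, ∑ i,
        stepSize x₀ ε reg g k * (g k i * (iterate x₀ ε reg g k i - xs i)) := by
    refine Finset.sum_congr rfl fun k _ => ?_
    rw [PiLp.inner_apply, Finset.mul_sum]
    refine Finset.sum_congr rfl fun i _ => ?_
    simp [mul_comm]
  rw [hl]
  refine hsum.trans ?_
  have hr : ∑ i, ((reg + accum g n i) * D ^ 2 / 2 + E ^ 2 * accum g n i)
      = (d * reg + ∑ i, accum g n i) * D ^ 2 / 2 + E ^ 2 * ∑ i, accum g n i := by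
    rw [Finset.sum_add_distrib, ← Finset.sum_div, ← Finset.sum_mul, Finset.sum_add_distrib,
      Finset.mul_sum]
    simp
  rw [hr]
  have := sum_le_sqrt_mul_norm (accum g n)
  gcongr

end Iterates

theorem norm_accum_sq (g : ℕ → Vec d) (t : ℕ) :
    ‖accum g t‖ ^ 2 = ∑ k ∈ Finset.range (t + 1), ‖g k‖ ^ 2 := by
  rw [EuclideanSpace.norm_sq_eq]
  simp_rw [EuclideanSpace.norm_sq_eq]
  rw [Finset.sum_comm]
  refine Finset.sum_congr rfl fun i _ => ?_
  change ‖Real.sqrt _‖ ^ 2 = _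
  rw [Real.norm_eq_abs, sq_abs, Real.sq_sqrt (Finset.sum_nonneg fun _ _ => sq_nonneg _)]
  simp

/-- Jensen's inequality for the weighted average, together with subgradient inequalities. -/
theorem average_sub_le {f : Vec d → ℝ} (hf : ConvexOn ℝ Set.univ f) {η : ℕ → ℝ}
    (hη : ∀ t, 0 ≤ η t) {x v : ℕ → Vec d} {xs : Vec d} {n : ℕ}
    (hv : ∀ k < n, v k ∈ subdifferential f (x k)) (hpos : 0 < ∑ k ∈ Finset.range n, η k) :
    (∑ k ∈ Finset.range n, η k) * (f (average η x n) - f xs)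
      ≤ ∑ k ∈ Finset.range n, η k * inner ℝ (v k) (x k - xs) := by
  have hJ := hf.map_centerMass_le (t := Finset.range n) (w := η) (p := x) (fun k _ => hη k) hpos
    (fun k _ => Set.mem_univ _)
  have h1 : (∑ k ∈ Finset.range n, η k) * f (average η x n)
      ≤ ∑ k ∈ Finset.range n, η k * f (x k) := by
    have : f (average η x n) ≤ (∑ k ∈ Finset.range n, η k)⁻¹
        * ∑ k ∈ Finset.range n, η k * f (x k) := hJ
    rwa [inv_mul_eq_div, le_div_iff₀' hpos] at this
  have h2 : ∑ k ∈ Finset.range n, η k * (f (x k) - f xs)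
      ≤ ∑ k ∈ Finset.range n, η k * inner ℝ (v k) (x k - xs) := by
    refine Finset.sum_le_sum fun k hk => mul_le_mul_of_nonneg_left ?_ (hη k)
    have := hv k (Finset.mem_range.1 hk) xs
    have h3 : inner ℝ (v k) (xs - x k) = - inner ℝ (v k) (x k - xs) := by
      rw [← inner_neg_right, neg_sub]
    linarith
  simp_rw [mul_sub, Finset.sum_sub_distrib, ← Finset.sum_mul] at h2
  linarith

/-! ### Self-normalized martingale concentration -/

theorem exp_sub_two_mul_sq_le {x : ℝ} (hx : |x| ≤ 1 / 5) : Real.exp (x - 2 * x ^ 2) ≤ 1 + x := by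
  obtain ⟨h1, h2⟩ := abs_le.1 hx
  have hu : |x - 2 * x ^ 2| ≤ 1 := abs_le.2 ⟨by nlinarith, by nlinarith⟩
  have h3 := (abs_le.1 (Real.abs_exp_sub_one_sub_id_le hu)).2
  have h4 : (x - 2 * x ^ 2) ^ 2 ≤ 2 * x ^ 2 := by
    have : (1 - 2 * x) ^ 2 ≤ 2 := by nlinarith
    calc (x - 2 * x ^ 2) ^ 2 = (1 - 2 * x) ^ 2 * x ^ 2 := by ring
      _ ≤ 2 * x ^ 2 := mul_le_mul_of_nonneg_right this (sq_nonneg x)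
  linarith

section Concentration

variable {Ω : Type*} {m : MeasurableSpace Ω} {μ : Measure Ω} {ℱ : Filtration ℕ m}

/-- Ville's maximal inequality for nonnegative supermartingales. -/
theorem mul_measureReal_exists_le_of_supermartingale [IsFiniteMeasure μ] {M : ℕ → Ω → ℝ}
    (hM : Supermartingale M ℱ μ) (h0 : 0 ≤ M) (c : ℝ) (n : ℕ) :
    c * μ.real {ω | ∃ k ≤ n, c ≤ M k ω} ≤ ∫ ω, M 0 ω ∂μ := by
  -- Stop at the first `k ≤ n` with `M k ≥ c`, or at `n` if there is none; optional stopping and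
  -- Markov's inequality conclude.
  set σ : Ω → ℕ∞ := fun ω => (hittingBtwn M (Set.Ici c) 0 n ω : ℕ) with hσ
  have hσst : IsStoppingTime ℱ σ :=
    hM.stronglyAdapted.adapted.isStoppingTime_hittingBtwn measurableSet_Ici
  have hbdd : ∀ ω, σ ω ≤ n := fun ω => Nat.cast_le.2 (hittingBtwn_le ω)
  have h1 := hM.neg.expected_stoppedValue_mono (isStoppingTime_const ℱ 0) hσst
    (fun _ => bot_le) hbdd
  have hint : Integrable (stoppedValue M σ) μ := by
    have h := hM.neg.integrable_stoppedValue hσst hbdd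
    have h2 : stoppedValue (-M) σ = - stoppedValue M σ := rfl
    rw [h2] at h
    simpa using h.neg
  have h2 : ∫ ω, stoppedValue M σ ω ∂μ ≤ ∫ ω, M 0 ω ∂μ := by
    have e1 : ∫ ω, stoppedValue (-M) σ ω ∂μ = - ∫ ω, stoppedValue M σ ω ∂μ :=
      integral_neg (stoppedValue M σ)
    have e2 : ∫ ω, stoppedValue (-M) (fun _ => ((0 : ℕ) : ℕ∞)) ω ∂μ = - ∫ ω, M 0 ω ∂μ :=
      integral_neg (M 0)
    change ∫ ω, stoppedValue (-M) (fun _ => ((0 : ℕ) : ℕ∞)) ω ∂μ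
      ≤ ∫ ω, stoppedValue (-M) σ ω ∂μ at h1
    rw [e1, e2] at h1
    linarith
  refine le_trans ?_ h2
  have h3 := mul_meas_ge_le_integral_of_nonneg
    (ae_of_all μ fun ω => (h0 _ ω : 0 ≤ stoppedValue M σ ω)) hint c
  rcases le_or_gt c 0 with hc | hc
  · exact (mul_nonpos_of_nonpos_of_nonneg hc measureReal_nonneg).trans
      (integral_nonneg fun ω => h0 _ ω)
  refine le_trans (mul_le_mul_of_nonneg_left (measureReal_mono ?_) hc.le) h3
  rintro ω ⟨k, hk, hck⟩
  exact stoppedValue_hittingBtwn_mem (u := M) (s := Set.Ici c) ⟨k, ⟨Nat.zero_le k, hk⟩, hck⟩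

/-- The exponential supermartingale built on a bounded adapted process. -/
noncomputable def expCompensated (μ : Measure Ω) (ℱ : Filtration ℕ m) (X : ℕ → Ω → ℝ) (t : ℝ)
    (n : ℕ) (ω : Ω) : ℝ :=
  Real.exp (∑ i ∈ Finset.range n, (t * ((μ[X i | ℱ i]) ω - X i ω) - 2 * (t * X i ω) ^ 2))

/-- Since $e^{-tX-2t^2X^2}\le1-tX$ when $|tX|\le1/5$, its conditional mean is at most $1-t\,\mathbb
E[X\mid\mathcal F]\le e^{-t\mathbb E[X\mid\mathcal F]}$. Compensating by observed squares avoids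
conditional variances. -/
theorem supermartingale_expCompensated [IsProbabilityMeasure μ] {X : ℕ → Ω → ℝ} {b t : ℝ}
    (hX : ∀ i, StronglyMeasurable[ℱ (i + 1)] (X i)) (hb : ∀ i, ∀ᵐ ω ∂μ, |X i ω| ≤ b)
    (ht : |t| * b ≤ 1 / 5) : Supermartingale (expCompensated μ ℱ X t) ℱ μ := by
  have htX : ∀ i, ∀ᵐ ω ∂μ, |t * X i ω| ≤ 1 / 5 := fun i => by
    filter_upwards [hb i] with ω hω
    rw [abs_mul]
    exact (mul_le_mul_of_nonneg_left hω (abs_nonneg t)).trans ht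
  have hXm : ∀ i, StronglyMeasurable[m] (X i) := fun i => (hX i).mono (ℱ.le _)
  have hXint : ∀ i, Integrable (X i) μ := fun i =>
    Integrable.of_bound (hXm i).aestronglyMeasurable b (by simpa using hb i)
  have hce : ∀ i, ∀ᵐ ω ∂μ, |(μ[X i | ℱ i]) ω| ≤ b := fun i => by
    have h1 := condExp_mono (m := ℱ i) (hXint i) (integrable_const b)
      ((hb i).mono fun ω hω => (abs_le.1 hω).2)
    have h2 := condExp_mono (m := ℱ i) (integrable_const (-b)) (hXint i)
      ((hb i).mono fun ω hω => (abs_le.1 hω).1)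
    rw [condExp_const (ℱ.le i)] at h1 h2
    filter_upwards [h1, h2] with ω h1 h2
    exact abs_le.2 ⟨h2, h1⟩
  have hadp : StronglyAdapted ℱ (expCompensated μ ℱ X t) := by
    intro n
    refine Real.continuous_exp.comp_stronglyMeasurable ?_
    refine Finset.stronglyMeasurable_fun_sum _ fun i hi => ?_
    have hin : i + 1 ≤ n := Finset.mem_range.1 hi
    have h1 : StronglyMeasurable[ℱ n] (X i) := (hX i).mono (ℱ.mono hin)
    have h2 : StronglyMeasurable[ℱ n] (μ[X i | ℱ i]) :=
      stronglyMeasurable_condExp.mono (ℱ.mono (by omega))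
    exact ((h2.sub h1).const_mul t).sub (((h1.const_mul t).pow 2).const_mul 2)
  have hbd : ∀ n, ∀ᵐ ω ∂μ, ‖expCompensated μ ℱ X t n ω‖ ≤ Real.exp (n * (2 / 5)) := by
    intro n
    have hall : ∀ᵐ ω ∂μ, ∀ i, |(μ[X i | ℱ i]) ω| ≤ b ∧ |t * X i ω| ≤ 1 / 5 :=
      ae_all_iff.2 fun i => (hce i).and (htX i)
    filter_upwards [hall] with ω hω
    rw [Real.norm_eq_abs, expCompensated, abs_of_pos (Real.exp_pos _), Real.exp_le_exp]
    calc _ ≤ ∑ _i ∈ Finset.range n, (2 / 5 : ℝ) := by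
          refine Finset.sum_le_sum fun i _ => ?_
          obtain ⟨h1, h2⟩ := hω i
          have h3 : |t * (μ[X i | ℱ i]) ω| ≤ 1 / 5 := by
            rw [abs_mul]
            exact (mul_le_mul_of_nonneg_left h1 (abs_nonneg t)).trans ht
          have h4 := (abs_le.1 h3).2
          have h5 := (abs_le.1 h2).1
          nlinarith [sq_nonneg (t * X i ω)]
      _ = n * (2 / 5) := by simp
  have hint : ∀ n, Integrable (expCompensated μ ℱ X t n) μ := fun n =>
    Integrable.of_bound ((hadp n).mono (ℱ.le n)).aestronglyMeasurable _ (hbd n)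
  refine supermartingale_nat hadp hint fun n => ?_
  set Z : Ω → ℝ := fun ω => Real.exp (-(t * X n ω) - 2 * (t * X n ω) ^ 2) with hZ
  set A : Ω → ℝ := fun ω => expCompensated μ ℱ X t n ω * Real.exp (t * (μ[X n | ℱ n]) ω) with hA
  have hfac : expCompensated μ ℱ X t (n + 1) = A * Z := by
    ext ω
    simp only [expCompensated, hA, hZ, Pi.mul_apply, Finset.sum_range_succ]
    rw [← Real.exp_add, ← Real.exp_add]
    congr 1
    ring
  have hAm : StronglyMeasurable[ℱ n] A :=
    (hadp n).mul (Real.continuous_exp.comp_stronglyMeasurable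
      (stronglyMeasurable_condExp.const_mul t))
  have hZle : ∀ᵐ ω ∂μ, Z ω ≤ 1 - t * X n ω := by
    filter_upwards [htX n] with ω hω
    have := exp_sub_two_mul_sq_le (x := -(t * X n ω)) (by rwa [abs_neg])
    rw [neg_sq] at this
    simpa [hZ, sub_eq_add_neg] using this
  have hZint : Integrable Z μ := by
    refine Integrable.of_bound (C := 6 / 5) ?_ ?_
    · refine (Real.continuous_exp.comp_stronglyMeasurable ?_).aestronglyMeasurable
      exact ((hXm n).const_mul t).neg.sub ((((hXm n).const_mul t).pow 2).const_mul 2)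
    · filter_upwards [hZle, htX n] with ω h1 h2
      rw [Real.norm_eq_abs, abs_of_pos (Real.exp_pos _)]
      have := (abs_le.1 h2).1
      linarith
  have hpull : μ[A * Z | ℱ n] =ᵐ[μ] A * μ[Z | ℱ n] :=
    condExp_mul_of_stronglyMeasurable_left hAm (hfac ▸ hint (n + 1)) hZint
  have hcZ : μ[Z | ℱ n] ≤ᵐ[μ] fun ω => 1 - t * (μ[X n | ℱ n]) ω := by
    have h1 : μ[Z | ℱ n] ≤ᵐ[μ] μ[(fun _ => (1 : ℝ)) - t • X n | ℱ n] :=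
      condExp_mono hZint ((integrable_const 1).sub ((hXint n).smul t)) hZle
    have h2 := condExp_sub (integrable_const (μ := μ) (1 : ℝ)) ((hXint n).smul t) (ℱ n)
    have h3 := condExp_smul (μ := μ) t (X n) (ℱ n)
    rw [condExp_const (ℱ.le n)] at h2
    filter_upwards [h1, h2, h3] with ω h1 h2 h3
    rw [h2] at h1
    simpa [h3] using h1
  rw [hfac]
  filter_upwards [hpull, hcZ] with ω h1 h2
  rw [h1, Pi.mul_apply]
  have hA0 : 0 ≤ A ω := mul_nonneg (Real.exp_pos _).le (Real.exp_pos _).le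
  refine (mul_le_mul_of_nonneg_left h2 hA0).trans ?_
  have h3 := Real.add_one_le_exp (-(t * (μ[X n | ℱ n]) ω))
  calc A ω * (1 - t * (μ[X n | ℱ n]) ω)
      ≤ A ω * Real.exp (-(t * (μ[X n | ℱ n]) ω)) := mul_le_mul_of_nonneg_left (by linarith) hA0
    _ = expCompensated μ ℱ X t n ω := by
        simp only [hA]
        rw [mul_assoc, ← Real.exp_add]
        simp

/-- A time-uniform self-normalized concentration inequality for bounded adapted processes. -/
theorem measureReal_exists_lt_abs_sum_le [IsProbabilityMeasure μ] {X : ℕ → Ω → ℝ} {b t p : ℝ}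
    (hX : ∀ i, StronglyMeasurable[ℱ (i + 1)] (X i)) (hb : ∀ i, ∀ᵐ ω ∂μ, |X i ω| ≤ b)
    (ht0 : 0 < t) (ht : t * b ≤ 1 / 5) (hp : 0 < p) (n : ℕ) :
    μ.real {ω | ∃ k ≤ n, 2 * t * ∑ i ∈ Finset.range k, X i ω ^ 2 + Real.log (2 / p) / t
      < |∑ i ∈ Finset.range k, ((μ[X i | ℱ i]) ω - X i ω)|} ≤ p := by
  -- The parameters `t` and `-t` handle the two signs of the sum, each with probability `p / 2`.
  have hside : ∀ s : ℝ, |s| = t →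
      μ.real {ω | ∃ k ≤ n, 2 / p ≤ expCompensated μ ℱ X s k ω} ≤ p / 2 := by
    intro s hs
    have h1 := mul_measureReal_exists_le_of_supermartingale
      (supermartingale_expCompensated (μ := μ) hX hb (t := s) (by rw [hs]; exact ht))
      (fun k ω => (Real.exp_pos _).le) (2 / p) n
    have h2 : ∫ ω, expCompensated μ ℱ X s 0 ω ∂μ = 1 := by simp [expCompensated]
    rw [h2, div_mul_eq_mul_div, div_le_one hp] at h1
    linarith
  refine (measureReal_mono (s₂ := {ω | ∃ k ≤ n, 2 / p ≤ expCompensated μ ℱ X t k ω}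
    ∪ {ω | ∃ k ≤ n, 2 / p ≤ expCompensated μ ℱ X (-t) k ω}) ?_).trans ?_
  · rintro ω ⟨k, hk, hlt⟩
    have hexp : ∀ s : ℝ, expCompensated μ ℱ X s k ω
        = Real.exp (s * (∑ i ∈ Finset.range k, ((μ[X i | ℱ i]) ω - X i ω))
          - 2 * s ^ 2 * ∑ i ∈ Finset.range k, X i ω ^ 2) := by
      intro s
      rw [expCompensated, Finset.mul_sum, Finset.mul_sum, ← Finset.sum_sub_distrib]
      congr 1
      exact Finset.sum_congr rfl fun i _ => by ring
    have hlog : ∀ s : ℝ, s ^ 2 = t ^ 2 →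
        s * (∑ i ∈ Finset.range k, ((μ[X i | ℱ i]) ω - X i ω))
          = t * |∑ i ∈ Finset.range k, ((μ[X i | ℱ i]) ω - X i ω)| →
        2 / p ≤ expCompensated μ ℱ X s k ω := by
      intro s hs2 hs
      rw [hexp, ← Real.log_le_iff_le_exp (by positivity), hs, hs2]
      have h1 := mul_lt_mul_of_pos_left hlt ht0
      have h2 : t * (Real.log (2 / p) / t) = Real.log (2 / p) := mul_div_cancel₀ _ ht0.ne'
      rw [mul_add, h2] at h1
      nlinarith
    rcases abs_cases (∑ i ∈ Finset.range k, ((μ[X i | ℱ i]) ω - X i ω)) with ⟨h, _⟩ | ⟨h, _⟩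
    · exact Or.inl ⟨k, hk, hlog t rfl (by rw [h])⟩
    · exact Or.inr ⟨k, hk, hlog (-t) (neg_sq t) (by rw [h]; ring)⟩
  · refine (measureReal_union_le _ _).trans ?_
    have h1 := hside t (abs_of_pos ht0)
    have h2 := hside (-t) (by rw [abs_neg, abs_of_pos ht0])
    linarith

end Concentration

/-! ### Normalized noise and the pathwise bound -/

/-- Holds even when the distance vanishes, since then `x k = xs`. -/
theorem inner_inv_maxDist_smul (x : ℕ → Vec d) (xs u : Vec d) (k : ℕ) :
    maxDist x xs k * inner ℝ u ((maxDist x xs k)⁻¹ • (x k - xs)) = inner ℝ u (x k - xs) := by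
  rw [inner_smul_right]
  rcases eq_or_ne (maxDist x xs k) 0 with h | h
  · have h1 := (norm_le_sqrt_mul_linfNorm (x k - xs)).trans
      (mul_le_mul_of_nonneg_left (linfNorm_le_maxDist x xs le_rfl) (Real.sqrt_nonneg d))
    rw [h, mul_zero] at h1
    rw [norm_le_zero_iff.1 h1]
    simp
  · rw [mul_inv_cancel_left₀ h]

theorem norm_inv_maxDist_smul_le (x : ℕ → Vec d) (xs : Vec d) (k : ℕ) :
    ‖(maxDist x xs k)⁻¹ • (x k - xs)‖ ≤ Real.sqrt d := by
  have h0 := maxDist_nonneg x xs k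
  rw [norm_smul, norm_inv, Real.norm_eq_abs, abs_of_nonneg h0, inv_mul_eq_div]
  refine div_le_of_le_mul₀ h0 (Real.sqrt_nonneg _) ?_
  exact (norm_le_sqrt_mul_linfNorm _).trans
    (mul_le_mul_of_nonneg_left (linfNorm_le_maxDist x xs le_rfl) (Real.sqrt_nonneg d))

/-- The pathwise guarantee of AdaGrad++ given a bound on the partial sums of the normalized
noise. -/
theorem average_le_of_noise_le {f : Vec d → ℝ} (hf : ConvexOn ℝ Set.univ f) {x₀ xs : Vec d}
    {ε reg κ W θ : ℝ} {g v : ℕ → Vec d} {T τ : ℕ} (hd : 0 < d) (hε0 : 0 < ε) (hreg : 0 ≤ reg)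
    (hκ : 0 ≤ κ) (hT : 1 ≤ T) (hτ : IsBestTime (stepSize x₀ ε reg g) T τ)
    (hε : ε ≤ κ * maxDist (iterate x₀ ε reg g) xs τ)
    (hv : ∀ k < τ, v k ∈ subdifferential f (iterate x₀ ε reg g k))
    (hregW : d * reg ≤ κ * W) (haccum : Real.sqrt d * ‖accum g τ‖ ≤ W) (hθ : 1 ≤ θ)
    (hnoise : ∀ k ≤ τ, |∑ i ∈ Finset.range k, inner ℝ (v i - g i)
      ((maxDist (iterate x₀ ε reg g) xs i)⁻¹ • (iterate x₀ ε reg g i - xs))| ≤ 6 * W * θ) :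
    f (average (stepSize x₀ ε reg g) (iterate x₀ ε reg g) τ) ≤ f xs
      + 12 * ((κ + 1) / 2 + (κ + 2) ^ 2 + 12 * (κ + 2)) * (1 / ε)
        * (maxDist (iterate x₀ ε reg g) xs τ ^ 2 * (W / T))
        * ((1 + Real.log (stepSize x₀ ε reg g T / stepSize x₀ ε reg g 0)) * θ) := by
  set x := iterate x₀ ε reg g with hx
  set η := stepSize x₀ ε reg g with hη
  set D := maxDist x xs τ with hD
  set L := Real.log (η T / η 0) with hL
  have hηm : Monotone η := stepSize_mono _ _ _ _
  have hη0 : η 0 = ε := rfl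
  have hηpos : ∀ t, 0 < η t := fun t => hε0.trans_le (le_stepSize _ _ _ _ t)
  have hητ : η τ ≤ (κ + 2) * D := stepSize_le x₀ ε reg g hd hκ hε le_rfl
  have hD0 : 0 ≤ D := maxDist_nonneg _ _ _
  have hW0 : 0 ≤ W := (mul_nonneg (Real.sqrt_nonneg _) (norm_nonneg _)).trans haccum
  have hTpos : (0 : ℝ) < T := by exact_mod_cast hT
  have hL0 : 0 ≤ L :=
    Real.log_nonneg ((one_le_div (hηpos 0)).2 (hηm (Nat.zero_le T)))
  have hsum := IsBestTime.le_sum hηm (hηpos 0) hT hτ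
  rw [← hL, hη0] at hsum
  set S := ∑ i ∈ Finset.range τ, η i with hS
  have hS0 : 0 < S := lt_of_lt_of_le (by positivity) hsum
  have hconv := average_sub_le hf (fun t => (hηpos t).le) (xs := xs) hv hS0
  have hsplit : ∑ k ∈ Finset.range τ, η k * inner ℝ (v k) (x k - xs)
      = ∑ k ∈ Finset.range τ, η k * inner ℝ (g k) (x k - xs)
        + ∑ k ∈ Finset.range τ, (η k * maxDist x xs k)
          * inner ℝ (v k - g k) ((maxDist x xs k)⁻¹ • (x k - xs)) := by
    rw [← Finset.sum_add_distrib]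
    refine Finset.sum_congr rfl fun k _ => ?_
    rw [mul_assoc, inner_inv_maxDist_smul, inner_sub_left]
    ring
  have hregret := sum_stepSize_mul_inner_le x₀ ε reg g (xs := xs) (n := τ) hε0.le hreg hητ
  have hnoise' := sum_mul_le_of_abs_sum_le (a := fun k => η k * maxDist x xs k)
    (fun i j hij => mul_le_mul (hηm hij) (maxDist_mono x xs hij) (maxDist_nonneg _ _ _)
      (hηpos j).le)
    (mul_nonneg (hηpos 0).le (maxDist_nonneg _ _ _)) τ hnoise
  rw [hsplit] at hconv
  have h1 : (d * reg + Real.sqrt d * ‖accum g τ‖) * D ^ 2 / 2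
        + ((κ + 2) * D) ^ 2 * (Real.sqrt d * ‖accum g τ‖)
      ≤ ((κ + 1) / 2 + (κ + 2) ^ 2) * (D ^ 2 * W) := by
    calc _ ≤ (κ * W + W) * D ^ 2 / 2 + ((κ + 2) * D) ^ 2 * W := by gcongr
      _ = _ := by ring
  have h2 : 2 * (η τ * D) * (6 * W * θ) ≤ 12 * (κ + 2) * (D ^ 2 * W) * θ := by
    calc _ ≤ 2 * (((κ + 2) * D) * D) * (6 * W * θ) := by gcongr
      _ = _ := by ring
  have h3 : ((κ + 1) / 2 + (κ + 2) ^ 2) * (D ^ 2 * W)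
      ≤ ((κ + 1) / 2 + (κ + 2) ^ 2) * (D ^ 2 * W) * θ :=
    le_mul_of_one_le_right (by positivity) hθ
  -- The summands come from the potential, the squared step sizes and the noise respectively.
  set K := (κ + 1) / 2 + (κ + 2) ^ 2 + 12 * (κ + 2) with hK
  have h4 : S * (f (average η x τ) - f xs) ≤ K * (D ^ 2 * W) * θ := by
    have : K * (D ^ 2 * W) * θ = ((κ + 1) / 2 + (κ + 2) ^ 2) * (D ^ 2 * W) * θ
        + 12 * (κ + 2) * (D ^ 2 * W) * θ := by rw [hK]; ring
    rw [this]
    refine hconv.trans ((add_le_add hregret hnoise').trans ?_)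
    exact add_le_add (h1.trans h3) h2
  rw [← sub_le_iff_le_add']
  have h5 : f (average η x τ) - f xs ≤ K * (D ^ 2 * W) * θ / S := (le_div_iff₀' hS0).2 h4
  refine h5.trans ?_
  have h6 : K * (D ^ 2 * W) * θ / S
      ≤ K * (D ^ 2 * W) * θ / (ε * T / (12 * (1 + L))) := by
    refine div_le_div_of_nonneg_left (by positivity) (by positivity) hsum
  refine h6.trans (le_of_eq ?_)
  field_simp

/-! ### Measurability and the noise event -/

section Measurability

variable {Ω : Type*}

theorem measurable_state {m : MeasurableSpace Ω} {ℱ : Filtration ℕ m} (x₀ : Vec d) (ε reg : ℝ)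
    {g : ℕ → Ω → Vec d} {N : ℕ} (hg : ∀ t < N, StronglyMeasurable[ℱ (t + 1)] (g t)) :
    ∀ t ≤ N, Measurable[ℱ t] (fun ω => iterate x₀ ε reg (fun k => g k ω) t) ∧
      Measurable[ℱ t] (fun ω => stepSize x₀ ε reg (fun k => g k ω) t) := by
  intro t
  induction t with
  | zero => exact fun _ => ⟨measurable_const, measurable_const⟩
  | succ t ih =>
    intro ht
    obtain ⟨hx, hη⟩ := ih (by omega)
    have hx' := hx.mono (ℱ.mono (Nat.le_succ t)) le_rfl
    have hη' := hη.mono (ℱ.mono (Nat.le_succ t)) le_rfl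
    have hgk : ∀ k < t + 1, Measurable[ℱ (t + 1)] (g k) := fun k hk =>
      (hg k (by omega)).measurable.mono (ℱ.mono (by omega)) le_rfl
    let _ : MeasurableSpace Ω := ℱ (t + 1)
    have happ : ∀ {u : Ω → Vec d}, Measurable u → ∀ i, Measurable fun ω => u ω i :=
      fun {u} hu i => (measurable_pi_apply i).comp ((WithLp.measurable_ofLp 2 _).comp hu)
    have hacc : ∀ i, Measurable fun ω => accum (fun k => g k ω) t i := fun i =>
      (Finset.measurable_fun_sum _ fun k hk =>
        (happ (hgk k (Finset.mem_range.1 hk)) i).pow_const 2).sqrt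
    have hit : Measurable fun ω => iterate x₀ ε reg (fun k => g k ω) (t + 1) := by
      refine (WithLp.measurable_toLp 2 _).comp (measurable_pi_lambda _ fun i => ?_)
      exact (happ hx' i).sub (hη'.mul
        (((measurable_const.add (hacc i)).inv).mul (happ (hgk t (Nat.lt_succ_self t)) i)))
    refine ⟨hit, ?_⟩
    simp_rw [stepSize_succ]
    exact hη'.max ((hit.sub measurable_const).norm.div_const _)

theorem measurable_maxDist [MeasurableSpace Ω] {x : ℕ → Ω → Vec d} (xs : Vec d) {t : ℕ}
    (hx : ∀ k ≤ t, Measurable (x k)) :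
    Measurable fun ω => maxDist (fun k => x k ω) xs t := by
  refine Finset.measurable_range_sup'' fun k hk => ?_
  exact ((WithLp.measurable_ofLp 2 _).comp ((hx k hk).sub measurable_const)).norm

end Measurability

variable {Ω : Type*} {m : MeasurableSpace Ω} {μ : Measure Ω} {ℱ : Filtration ℕ m}

/-- The normalized direction is $\mathcal F_i$-measurable, so it passes through the conditional
expectation and the scalar concentration bound applies. -/
theorem IsOracleAnswer.measureReal_noise_le [IsProbabilityMeasure μ] {f l : Vec d → ℝ}
    {x g : ℕ → Ω → Vec d} {T : ℕ} {G t p : ℝ} (h : IsOracleAnswer μ ℱ f l x g T)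
    (hl : ∀ y, l y ≤ G) (hx : ∀ k ≤ T, Measurable[ℱ k] (x k)) (xs : Vec d) (hG : 0 ≤ G)
    (ht0 : 0 < t) (ht : t * (Real.sqrt d * G) ≤ 1 / 5) (hp : 0 < p) :
    μ.real {ω | ∃ k ≤ T, 2 * t * (d * ∑ i ∈ Finset.range k, ‖g i ω‖ ^ 2) + Real.log (2 / p) / t
      < |∑ i ∈ Finset.range k, inner ℝ ((μ[g i | ℱ i]) ω - g i ω)
        ((maxDist (fun j => x j ω) xs i)⁻¹ • (x i ω - xs))|} ≤ p := by
  set u : ℕ → Ω → Vec d := fun i ω => (maxDist (fun j => x j ω) xs i)⁻¹ • (x i ω - xs) with hu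
  have hum : ∀ i ≤ T, StronglyMeasurable[ℱ i] (u i) := fun i hi => by
    have hxj : ∀ j ≤ i, Measurable[ℱ i] (x j) := fun j hj =>
      (hx j (hj.trans hi)).mono (ℱ.mono hj) le_rfl
    let _ : MeasurableSpace Ω := ℱ i
    exact ((measurable_maxDist xs hxj).inv.smul
      ((hxj i le_rfl).sub measurable_const)).stronglyMeasurable
  have hub : ∀ i ω, ‖u i ω‖ ≤ Real.sqrt d := fun i ω => norm_inv_maxDist_smul_le _ _ _
  have hgb : ∀ i ≤ T, ∀ᵐ ω ∂μ, ‖g i ω‖ ≤ G := fun i hi =>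
    (h.norm_le i hi).mono fun ω hω => hω.trans (hl _)
  have hgm : ∀ i ≤ T, StronglyMeasurable[m] (g i) := fun i hi =>
    (h.measurable_answer i hi).mono (ℱ.le _)
  have hgint : ∀ i ≤ T, Integrable (g i) μ := fun i hi =>
    Integrable.of_bound (hgm i hi).aestronglyMeasurable G (hgb i hi)
  -- Extension by zero beyond `T`, where nothing is known about the oracle.
  set X : ℕ → Ω → ℝ := fun i ω => if i ≤ T then inner ℝ (g i ω) (u i ω) else 0 with hX
  have hXi : ∀ i ≤ T, X i = fun ω => inner ℝ (g i ω) (u i ω) := fun i hi => by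
    ext ω; simp [hX, hi]
  have hX0 : ∀ i, ¬ i ≤ T → X i = fun _ => 0 := fun i hi => by ext ω; simp [hX, hi]
  have hXm : ∀ i, StronglyMeasurable[ℱ (i + 1)] (X i) := fun i => by
    by_cases hi : i ≤ T
    · rw [hXi i hi]
      exact (h.measurable_answer i hi).inner ((hum i hi).mono (ℱ.mono (Nat.le_succ i)))
    · rw [hX0 i hi]
      exact stronglyMeasurable_const
  have hXb : ∀ i, ∀ᵐ ω ∂μ, |X i ω| ≤ Real.sqrt d * G := fun i => by
    by_cases hi : i ≤ T
    · filter_upwards [hgb i hi] with ω hω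
      rw [hXi i hi, mul_comm]
      exact (abs_real_inner_le_norm _ _).trans
        (mul_le_mul hω (hub i ω) (norm_nonneg _) hG)
    · simp only [hX0 i hi, abs_zero]
      exact ae_of_all μ fun _ => mul_nonneg (Real.sqrt_nonneg _) hG
  have hce : ∀ i ≤ T, ∀ᵐ ω ∂μ, (μ[X i | ℱ i]) ω = inner ℝ ((μ[g i | ℱ i]) ω) (u i ω) :=
    fun i hi => by
      have hint : Integrable (X i) μ := Integrable.of_bound
        ((hXm i).mono (ℱ.le _)).aestronglyMeasurable _ (hXb i)
      rw [hXi i hi] at hint ⊢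
      exact condExp_bilin_of_stronglyMeasurable_right (innerSL ℝ) (hum i hi) hint (hgint i hi)
  have hall : ∀ᵐ ω ∂μ, ∀ i, i ≤ T → (μ[X i | ℱ i]) ω = inner ℝ ((μ[g i | ℱ i]) ω) (u i ω) :=
    ae_all_iff.2 fun i => by
      by_cases hi : i ≤ T
      · exact (hce i hi).mono fun _ h _ => h
      · exact ae_of_all μ fun _ h => absurd h hi
  refine le_trans ?_ (measureReal_exists_lt_abs_sum_le (μ := μ) hXm hXb ht0 ht hp T)
  refine ENNReal.toReal_mono (measure_ne_top _ _) (measure_mono_ae ?_)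
  filter_upwards [hall] with ω hω
  rintro ⟨k, hk, hlt⟩
  refine ⟨k, hk, ?_⟩
  have hin : ∀ i ∈ Finset.range k, i ≤ T := fun i hi => (Finset.mem_range.1 hi).le.trans hk
  have e1 : ∑ i ∈ Finset.range k, ((μ[X i | ℱ i]) ω - X i ω)
      = ∑ i ∈ Finset.range k, inner ℝ ((μ[g i | ℱ i]) ω - g i ω) (u i ω) :=
    Finset.sum_congr rfl fun i hi => by
      rw [hω i (hin i hi), hXi i (hin i hi), inner_sub_left]
  have e2 : ∑ i ∈ Finset.range k, X i ω ^ 2 ≤ d * ∑ i ∈ Finset.range k, ‖g i ω‖ ^ 2 := by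
    rw [Finset.mul_sum]
    refine Finset.sum_le_sum fun i hi => ?_
    rw [hXi i (hin i hi), ← sq_abs]
    calc |inner ℝ (g i ω) (u i ω)| ^ 2 ≤ (‖g i ω‖ * Real.sqrt d) ^ 2 :=
          pow_le_pow_left₀ (abs_nonneg _) ((abs_real_inner_le_norm _ _).trans
            (mul_le_mul_of_nonneg_left (hub i ω) (norm_nonneg _))) 2
      _ = d * ‖g i ω‖ ^ 2 := by
          rw [mul_pow, Real.sq_sqrt (Nat.cast_nonneg d), mul_comm]
  rw [e1]
  refine lt_of_le_of_lt ?_ hlt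
  have := mul_le_mul_of_nonneg_left e2 (by positivity : 0 ≤ 2 * t)
  linarith

theorem one_le_log_six_mul {T : ℕ} (hT : 1 ≤ T) : 1 ≤ Real.log (6 * T) := by
  have hT' : (1 : ℝ) ≤ T := by exact_mod_cast hT
  rw [Real.le_log_iff_exp_le (by positivity)]
  have := Real.exp_one_lt_three
  linarith

theorem log_two_div_le_log {T : ℕ} {p : ℝ} (hT : 1 ≤ T) (hp : 0 < p) :
    Real.log (2 / p) ≤ Real.log (60 * Real.log (6 * T) / p) := by
  have h1 := one_le_log_six_mul hT
  refine Real.log_le_log (by positivity) ?_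
  gcongr
  linarith

theorem one_le_log_div {T : ℕ} {p : ℝ} (hT : 1 ≤ T) (hp : 0 < p) (hp1 : p < 1) :
    1 ≤ Real.log (60 * Real.log (6 * T) / p) := by
  have h1 := one_le_log_six_mul hT
  have h2 : (3 : ℝ) ≤ 60 * Real.log (6 * T) / p := by
    rw [le_div_iff₀ hp]
    nlinarith
  rw [Real.le_log_iff_exp_le (by linarith)]
  exact Real.exp_one_lt_three.le.trans h2

end AdaGradPP

/-! ### Assembly of the high-probability bound -/

theorem corollary2 (κ : ℝ) (hκ : 0 < κ) :
    ∃ C : ℝ, 0 < C ∧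
      ∀ (d : ℕ) (_ : 0 < d)
        (f : AdaGradPP.Vec d → ℝ) (_ : ConvexOn ℝ Set.univ f)
        (l : AdaGradPP.Vec d → ℝ) (_ : Continuous l)
        (G : ℝ) (_ : 0 < G) (_ : ∀ x, l x ≤ G)
        (x₀ : AdaGradPP.Vec d) (ε reg : ℝ) (_ : 0 < ε) (_ : 0 ≤ reg)
        (_ : reg * Real.sqrt d ≤ κ * G)
        (Ω : Type*) (m : MeasurableSpace Ω) (μ : Measure Ω) (_ : IsProbabilityMeasure μ)
        (ℱ : Filtration ℕ m) (T : ℕ) (_ : 1 ≤ T)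
        (g : ℕ → Ω → AdaGradPP.Vec d) (x : ℕ → Ω → AdaGradPP.Vec d) (η : ℕ → Ω → ℝ)
        (_ : ∀ t ω, x t ω = AdaGradPP.iterate x₀ ε reg (fun k => g k ω) t)
        (_ : ∀ t ω, η t ω = AdaGradPP.stepSize x₀ ε reg (fun k => g k ω) t)
        (_ : AdaGradPP.IsOracleAnswer μ ℱ f l x g T)
        (τ : Ω → ℕ) (_ : Measurable τ)
        (_ : ∀ ω, AdaGradPP.IsBestTime (fun t => η t ω) T (τ ω))
        (α : ℝ) (_ : 0 ≤ α) (_ : α ≤ 1 / 2)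
        (_ : ∀ᵐ ω ∂μ, ‖AdaGradPP.accum (fun k => g k ω) (τ ω)‖ ≤ G * (T : ℝ) ^ (1 / 2 - α))
        (xs : AdaGradPP.Vec d)
        (_ : ∀ᵐ ω ∂μ, ε ≤ κ * AdaGradPP.maxDist (fun t => x t ω) xs (τ ω))
        (p : ℝ) (_ : 0 < p) (_ : p < 1),
        ENNReal.ofReal (1 - p) ≤
          μ {ω | f (AdaGradPP.average (fun t => η t ω) (fun t => x t ω) (τ ω)) ≤
            f xs + C * (1 / ε) *
              ((AdaGradPP.maxDist (fun t => x t ω) xs (τ ω)) ^ 2 * G * Real.sqrt d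
                / (T : ℝ) ^ (1 / 2 + α))
              * AdaGradPP.logFactor (fun t => η t ω) T p} := by
  refine ⟨12 * ((κ + 1) / 2 + (κ + 2) ^ 2 + 12 * (κ + 2)), by positivity, ?_⟩
  intro d hd f hf l _ G hG hl x₀ ε reg hε0 hreg hregG Ω m μ _ ℱ T hT g x η hx hη hora τ _ hτ α _
    hα haccum xs hε p hp hp1
  have hTpos : (0 : ℝ) < T := by exact_mod_cast hT
  have hsd : 0 < Real.sqrt d := Real.sqrt_pos.2 (by exact_mod_cast hd)
  set P := (T : ℝ) ^ (1 / 2 - α) with hP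
  have hP1 : 1 ≤ P := Real.one_le_rpow (by exact_mod_cast hT) (by linarith)
  set W := Real.sqrt d * (G * P) with hW
  have hW0 : 0 < W := by positivity
  set θ := Real.log (60 * Real.log (6 * T) / p) with hθ
  have hθ1 : 1 ≤ θ := AdaGradPP.one_le_log_div hT hp hp1
  have hθ2 : Real.log (2 / p) ≤ θ := AdaGradPP.log_two_div_le_log hT hp
  have hxm : ∀ k ≤ T, Measurable[ℱ k] (x k) := fun k hk => by
    have := (AdaGradPP.measurable_state x₀ ε reg
      (fun t (ht : t < T) => hora.measurable_answer t ht.le) k hk).1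
    rwa [← funext (hx k)] at this
  -- With `t = 1 / (5 * W)`, the two terms of the deviation bound are at most `2 * W / 5` and `5 * W
  -- * θ`, in total at most `6 * W * θ`. Admissibility of `t` needs `√d * G ≤ W`, that is `P ≥ 1`.
  have hbad := hora.measureReal_noise_le hl hxm xs hG.le (t := 1 / (5 * W)) (p := p)
    (by positivity) (by
      rw [one_div, inv_mul_le_iff₀ (by positivity), hW]
      nlinarith [mul_pos hsd hG]) hp
  set bad := {ω | ∃ k ≤ T, 2 * (1 / (5 * W)) * (d * ∑ i ∈ Finset.range k, ‖g i ω‖ ^ 2)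
      + Real.log (2 / p) / (1 / (5 * W))
      < |∑ i ∈ Finset.range k, inner ℝ ((μ[g i | ℱ i]) ω - g i ω)
        ((AdaGradPP.maxDist (fun j => x j ω) xs i)⁻¹ • (x i ω - xs))|} with hbaddef
  set good := {ω | f (AdaGradPP.average (fun t => η t ω) (fun t => x t ω) (τ ω)) ≤
            f xs + 12 * ((κ + 1) / 2 + (κ + 2) ^ 2 + 12 * (κ + 2)) * (1 / ε) *
              ((AdaGradPP.maxDist (fun t => x t ω) xs (τ ω)) ^ 2 * G * Real.sqrt d
                / (T : ℝ) ^ (1 / 2 + α))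
              * AdaGradPP.logFactor (fun t => η t ω) T p} with hgooddef
  have hunb : ∀ᵐ ω ∂μ, ∀ t, t ≤ T → (μ[g t | ℱ t]) ω ∈ AdaGradPP.subdifferential f (x t ω) :=
    ae_all_iff.2 fun t => by
      by_cases ht : t ≤ T
      · exact (hora.unbiased t ht).mono fun _ h _ => h
      · exact ae_of_all μ fun _ h => absurd h ht
  have hcover : ∀ᵐ ω ∂μ, ω ∈ good ∪ bad := by
    filter_upwards [haccum, hε, hunb] with ω haccω hεω hunbω
    by_cases hω : ω ∈ bad
    · exact Or.inr hω
    refine Or.inl ?_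
    have hxω : (fun t => x t ω) = AdaGradPP.iterate x₀ ε reg (fun k => g k ω) :=
      funext fun t => hx t ω
    have hηω : (fun t => η t ω) = AdaGradPP.stepSize x₀ ε reg (fun k => g k ω) :=
      funext fun t => hη t ω
    have hbest := hτ ω
    have hacc' : Real.sqrt d * ‖AdaGradPP.accum (fun k => g k ω) (τ ω)‖ ≤ W :=
      mul_le_mul_of_nonneg_left haccω hsd.le
    have hregW : d * reg ≤ κ * W := by
      have h1 : Real.sqrt d * Real.sqrt d = d := Real.mul_self_sqrt (Nat.cast_nonneg d)
      calc (d : ℝ) * reg = Real.sqrt d * (reg * Real.sqrt d) := by linear_combination (-reg) * h1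
        _ ≤ Real.sqrt d * (κ * G) := mul_le_mul_of_nonneg_left hregG hsd.le
        _ ≤ Real.sqrt d * (κ * G) * P := le_mul_of_one_le_right (by positivity) hP1
        _ = κ * W := by rw [hW]; ring
    have hnoise : ∀ k ≤ τ ω, |∑ i ∈ Finset.range k, inner ℝ ((μ[g i | ℱ i]) ω - g i ω)
        ((AdaGradPP.maxDist (fun j => x j ω) xs i)⁻¹ • (x i ω - xs))| ≤ 6 * W * θ := by
      intro k hk
      have h1 : ¬ _ := fun h => hω ⟨k, hk.trans hbest.1, h⟩
      refine (not_lt.1 h1).trans ?_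
      have h2 : d * ∑ i ∈ Finset.range k, ‖g i ω‖ ^ 2 ≤ W ^ 2 := by
        calc d * ∑ i ∈ Finset.range k, ‖g i ω‖ ^ 2
            ≤ d * ∑ i ∈ Finset.range (τ ω + 1), ‖g i ω‖ ^ 2 := by
              refine mul_le_mul_of_nonneg_left ?_ (Nat.cast_nonneg d)
              exact Finset.sum_le_sum_of_subset_of_nonneg
                (Finset.range_mono (hk.trans (Nat.le_succ _))) fun _ _ _ => sq_nonneg _
          _ = (Real.sqrt d * ‖AdaGradPP.accum (fun k => g k ω) (τ ω)‖) ^ 2 := by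
              rw [mul_pow, Real.sq_sqrt (Nat.cast_nonneg d), AdaGradPP.norm_accum_sq]
          _ ≤ W ^ 2 := pow_le_pow_left₀ (by positivity) hacc' 2
      have h3 : 2 * (1 / (5 * W)) * (d * ∑ i ∈ Finset.range k, ‖g i ω‖ ^ 2) ≤ W * (2 / 5) := by
        calc _ ≤ 2 * (1 / (5 * W)) * W ^ 2 := mul_le_mul_of_nonneg_left h2 (by positivity)
          _ = W * (2 / 5) := by field_simp
      have h4 : Real.log (2 / p) / (1 / (5 * W)) ≤ 5 * W * θ := by
        rw [div_div_eq_mul_div, div_one, mul_comm]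
        exact mul_le_mul_of_nonneg_left hθ2 (by positivity)
      nlinarith
    rw [hgooddef, Set.mem_ofPred_eq, hηω, hxω]
    rw [hηω] at hbest
    rw [hxω] at hεω
    have hmain := AdaGradPP.average_le_of_noise_le hf (κ := κ) (W := W) (θ := θ) hd hε0 hreg hκ.le
      hT hbest hεω (v := fun i => (μ[g i | ℱ i]) ω)
      (fun k hk => by
        have := hunbω k (hk.le.trans hbest.1)
        rwa [hx k ω] at this)
      hregW hacc' hθ1
      (fun k hk => by
        have := hnoise k hk
        rw [hxω] at this
        simp_rw [hx] at this
        exact this)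
    -- The exponents `1 / 2 + α` and `1 / 2 - α` add up to one.
    have hWT : ∀ a : ℝ, a * (W / T) = a * G * Real.sqrt d / (T : ℝ) ^ (1 / 2 + α) := by
      intro a
      have hmul : (T : ℝ) ^ (1 / 2 + α) * P = T := by
        rw [hP, ← Real.rpow_add hTpos]
        norm_num
      have hQ : 0 < (T : ℝ) ^ (1 / 2 + α) := Real.rpow_pos_of_pos hTpos _
      rw [mul_div_assoc', div_eq_div_iff hTpos.ne' hQ.ne', hW]
      conv_rhs => rw [← hmul]
      ring
    rw [hWT] at hmain
    exact hmain
  have huniv : 1 ≤ μ (good ∪ bad) := by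
    rw [← measure_univ (μ := μ)]
    exact measure_mono_ae (hcover.mono fun _ h _ => h)
  have hbad' : μ bad ≤ ENNReal.ofReal p := by
    rw [← ofReal_measureReal (measure_ne_top μ bad)]
    exact ENNReal.ofReal_le_ofReal hbad
  rw [ENNReal.ofReal_sub 1 hp.le, ENNReal.ofReal_one, tsub_le_iff_right]
  exact huniv.trans ((measure_union_le _ _).trans (add_le_add le_rfl hbad'))
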